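/- Let $\tau_1,\dots,\tau_N$ be a sporadic task system with constrained deadlines, indexed by decreasing priority. Task $\tau_i$ has worst-case execution time $C_i>0$, period (minimum time between two consecutive job releases) $T_i>0$, relative deadline $D_i$ with $0<D_i\le T_i$, and utilization $U_i=C_i/T_i$. A job of $\tau_i$ released at time $r\ge 0$ has absolute deadline $r+D_i$ and needs at most $C_i$ units of execution; successive jobs of one task are executed in sequence. The jobs are scheduled by preemptive global fixed-priority scheduling on $M\ge 1$ identical processors: at any time, the (at most) $M$ highest-priority jobs in the ready queue are executed. Task $\tau_k$ is schedulable if, for all legal release and execution times, all of its jobs finish by their absolute deadlines. Let $\Delta_k^{\max}=\max\left(\{U_j: j<k\}\cup\{C_k/D_k\}\right)$, and let $\pi(1),\dots,\pi(k-1)$ be an enumeration of the higher-priority tasks $1,\dots,k-1$ with $T_{\pi(1)}\ge T_{\pi(2)}\ge\dots\ge T_{\pi(k-1)}$. Suppose that $\sum_{i=1}^{k}U_i\le M$, that $\sum_{i=1}^{k-1}\frac{C_i}{D_k}\le M$, and that $$\Delta_k^{\max}\le 1-\frac1M\sum_{i=1}^{k-1}\left(U_{\pi(i)}+\frac{C_{\pi(i)}}{D_k}\right)+\frac1{M^2}\sum_{i=1}^{k-1}U_{\pi(i)}\sum_{\ell=i}^{k-1}\frac{C_{\pi(\ell)}}{D_k}.$$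 Then $\tau_k$ is schedulable. Moreover, there are a single program and a constant $c$ such that, for all $M\ge1$, all $k\ge2$ and all tasks, the program decides whether these three conditions hold in at most $c\,k\log k$ steps, given $M$, $\tau_k$ and the list of the higher-priority tasks (not sorted by periods). Here arithmetic operations and comparisons on real numbers, accesses to variables, operations on list cells, branches and function calls cost one step each. -/

import Mathlib

namespace GlobalFP

/-! ## Sporadic tasks -/

/-- A sporadic task with worst-case execution time `C`, minimum inter-arrival time (period) `T`
and relative deadline `D`. -/
structure SporadicTask where
  C : ℝ
  T : ℝ
  D : ℝ
  C_pos : 0 < C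
  T_pos : 0 < T
  D_pos : 0 < D

namespace SporadicTask

/-- The utilization of a task. -/
noncomputable def U (x : SporadicTask) : ℝ := x.C / x.T

end SporadicTask

/-- The system has constrained deadlines. -/
def ConstrainedDeadlines {N : ℕ} (τ : Fin N → SporadicTask) : Prop :=
  ∀ i, (τ i).D ≤ (τ i).T

/-! ## Job releases and schedules

Tasks are indexed by priority: task `i` has higher priority than task `j` iff `i < j`.
Releases of one task are at distinct times, so a job is the pair of its task and release time. -/

/-- A legal job pattern of the system: the release times of each task and the actual execution
times of its jobs (`exec i r` is only relevant for `r ∈ release i`). -/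
structure JobPattern {N : ℕ} (τ : Fin N → SporadicTask) where
  release : Fin N → Set ℝ
  exec : Fin N → ℝ → ℝ
  release_nonneg : ∀ i, ∀ r ∈ release i, 0 ≤ r
  separated : ∀ i, ∀ r ∈ release i, ∀ r' ∈ release i, r < r' → r + (τ i).T ≤ r'
  exec_nonneg : ∀ i, ∀ r ∈ release i, 0 ≤ exec i r
  exec_le : ∀ i, ∀ r ∈ release i, exec i r ≤ (τ i).C

/-- The amount of execution that job `(i, r)` receives before time `t`, where `run i r` is the set
of times at which that job occupies a processor. -/
noncomputable def service {N : ℕ} (run : Fin N → ℝ → Set ℝ) (i : Fin N) (r t : ℝ) : ℝ :=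
  MeasureTheory.volume.real (run i r ∩ Set.Ico r t)

/-- Job `(i, r)` has been released and is not completed at time `t`. -/
def Pending {N : ℕ} {τ : Fin N → SporadicTask} (J : JobPattern τ) (run : Fin N → ℝ → Set ℝ)
    (i : Fin N) (r t : ℝ) : Prop :=
  r ∈ J.release i ∧ r ≤ t ∧ service run i r t < J.exec i r

/-- Job `(i, r)` is in the ready queue at time `t`: it is pending and, as the jobs of a task are
executed in sequence, all earlier jobs of its task are completed. -/
def Ready {N : ℕ} {τ : Fin N → SporadicTask} (J : JobPattern τ) (run : Fin N → ℝ → Set ℝ)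
    (i : Fin N) (r t : ℝ) : Prop :=
  Pending J run i r t ∧ ∀ r', r' < r → ¬ Pending J run i r' t

/-- `run` is the preemptive global fixed-priority schedule of the job pattern `J` on `M` identical
unit-speed processors: at any time, exactly the (at most) `M` highest-priority jobs in the ready
queue are executed. A task never has two ready jobs at once, so that the number of ready jobs of
higher priority is the number of higher-priority tasks with a ready job. -/
structure IsGlobalFPSchedule {N : ℕ} (M : ℕ) {τ : Fin N → SporadicTask} (J : JobPattern τ)
    (run : Fin N → ℝ → Set ℝ) : Prop where
  measurable : ∀ i r, MeasurableSet (run i r)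
  dispatch : ∀ i r t, t ∈ run i r ↔
    Ready J run i r t ∧ {j : Fin N | j < i ∧ ∃ r', Ready J run j r' t}.ncard < M

/-- Task `k` is schedulable by global fixed-priority scheduling on `M` processors: whatever the
legal job pattern, all of its jobs are completed by their absolute deadlines. -/
def Schedulable {N : ℕ} (M : ℕ) (τ : Fin N → SporadicTask) (k : Fin N) : Prop :=
  ∀ (J : JobPattern τ) (run : Fin N → ℝ → Set ℝ), IsGlobalFPSchedule M J run →
    ∀ r ∈ J.release k, J.exec k r ≤ service run k r (r + (τ k).D)

/-! ## The schedulability test -/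

/-- The maximum of `C_k / D_k` and of the utilizations of the tasks of higher priority than `k`. -/
noncomputable def DeltaMax {N : ℕ} (τ : Fin N → SporadicTask) (k : Fin N) : ℝ :=
  (Finset.Iio k).fold max ((τ k).C / (τ k).D) (fun j => (τ j).U)

/-- The quadratic test for task `k`. Here `σ` enumerates the higher-priority tasks by non-increasing
period; one exists always, and how it breaks ties does not affect the inequality. -/
structure QuadraticTest {N : ℕ} (M : ℕ) (τ : Fin N → SporadicTask) (k : Fin N) : Prop where
  total_utilization : ∑ i ∈ Finset.Iic k, (τ i).U ≤ M
  total_density : ∑ i ∈ Finset.Iio k, (τ i).C / (τ k).D ≤ M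
  quadratic : ∃ σ : Fin (k : ℕ) ≃ {i : Fin N // i < k},
    Antitone (fun a => (τ (σ a)).T) ∧
    DeltaMax τ k ≤
      1 - 1 / (M : ℝ) * ∑ a, ((τ (σ a)).U + (τ (σ a)).C / (τ k).D)
        + 1 / (M : ℝ) ^ 2 *
          ∑ a, (τ (σ a)).U * ∑ b ∈ Finset.Ici a, (τ (σ b)).C / (τ k).D

/-! ## The machine model

A unit-cost model over the reals: a first-order recursive language whose data are real numbers and
cons cells holding references. Arithmetic operations and comparisons on reals, accesses to
variables, operations on cons cells, branches and calls take one step each. -/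

/-- Data: real numbers, the empty list, and cons cells. -/
inductive Val where
  | real (x : ℝ)
  | nil
  | cons (a b : Val)

/-- The arithmetic operations. -/
inductive ArithOp where
  | add
  | sub
  | mul
  | div

/-- Expressions. `var i` is the `i`-th most recently bound variable; `letIn a b` evaluates `a`,
binds it, and evaluates `b`; `call f a` calls function number `f` of the program with argument `a`.
There are no other data-dependent branches than `ifNil` and `ifLe`. -/
inductive Code where
  | var (i : ℕ)
  | const (n : ℕ)
  | arith (op : ArithOp) (a b : Code)
  | nil
  | cons (a b : Code)
  | head (a : Code)
  | tail (a : Code)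
  | letIn (a b : Code)
  | ifNil (a b c : Code)
  | ifLe (a b c d : Code)
  | call (f : ℕ) (a : Code)

/-- A program is a finite list of one-argument functions, given by their bodies. -/
abbrev Program := List Code

/-- `ArithResult op x y z`: the operation `op` applied to `x` and `y` yields `z`. Division by zero
yields nothing. -/
inductive ArithResult : ArithOp → ℝ → ℝ → ℝ → Prop where
  | add (x y : ℝ) : ArithResult .add x y (x + y)
  | sub (x y : ℝ) : ArithResult .sub x y (x - y)
  | mul (x y : ℝ) : ArithResult .mul x y (x * y)
  | div (x y : ℝ) (hy : y ≠ 0) : ArithResult .div x y (x / y)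

/-- `Evaluates P env e v n`: in the environment `env`, the expression `e` evaluates to `v` in
exactly `n` steps. -/
inductive Evaluates (P : Program) : List Val → Code → Val → ℕ → Prop where
  | var {env : List Val} {i : ℕ} {v : Val} (h : env[i]? = some v) :
      Evaluates P env (.var i) v 1
  | const {env : List Val} (m : ℕ) :
      Evaluates P env (.const m) (.real m) 1
  | arith {env : List Val} {op : ArithOp} {a b : Code} {x y z : ℝ} {n₁ n₂ : ℕ}
      (ha : Evaluates P env a (.real x) n₁) (hb : Evaluates P env b (.real y) n₂)
      (hz : ArithResult op x y z) :
      Evaluates P env (.arith op a b) (.real z) (n₁ + n₂ + 1)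
  | nil {env : List Val} :
      Evaluates P env .nil .nil 1
  | cons {env : List Val} {a b : Code} {u v : Val} {n₁ n₂ : ℕ}
      (ha : Evaluates P env a u n₁) (hb : Evaluates P env b v n₂) :
      Evaluates P env (.cons a b) (.cons u v) (n₁ + n₂ + 1)
  | head {env : List Val} {a : Code} {u v : Val} {n : ℕ}
      (ha : Evaluates P env a (.cons u v) n) :
      Evaluates P env (.head a) u (n + 1)
  | tail {env : List Val} {a : Code} {u v : Val} {n : ℕ}
      (ha : Evaluates P env a (.cons u v) n) :
      Evaluates P env (.tail a) v (n + 1)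
  | letIn {env : List Val} {a b : Code} {u v : Val} {n₁ n₂ : ℕ}
      (ha : Evaluates P env a u n₁) (hb : Evaluates P (u :: env) b v n₂) :
      Evaluates P env (.letIn a b) v (n₁ + n₂ + 1)
  | ifNil_nil {env : List Val} {a b c : Code} {v : Val} {n₁ n₂ : ℕ}
      (ha : Evaluates P env a .nil n₁) (hb : Evaluates P env b v n₂) :
      Evaluates P env (.ifNil a b c) v (n₁ + n₂ + 1)
  | ifNil_cons {env : List Val} {a b c : Code} {u w v : Val} {n₁ n₂ : ℕ}
      (ha : Evaluates P env a (.cons u w) n₁) (hc : Evaluates P env c v n₂) :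
      Evaluates P env (.ifNil a b c) v (n₁ + n₂ + 1)
  | ifLe_true {env : List Val} {a b c d : Code} {x y : ℝ} {v : Val} {n₁ n₂ n₃ : ℕ}
      (ha : Evaluates P env a (.real x) n₁) (hb : Evaluates P env b (.real y) n₂)
      (hxy : x ≤ y) (hc : Evaluates P env c v n₃) :
      Evaluates P env (.ifLe a b c d) v (n₁ + n₂ + n₃ + 1)
  | ifLe_false {env : List Val} {a b c d : Code} {x y : ℝ} {v : Val} {n₁ n₂ n₃ : ℕ}
      (ha : Evaluates P env a (.real x) n₁) (hb : Evaluates P env b (.real y) n₂)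
      (hxy : y < x) (hd : Evaluates P env d v n₃) :
      Evaluates P env (.ifLe a b c d) v (n₁ + n₂ + n₃ + 1)
  | call {env : List Val} {f : ℕ} {a body : Code} {u v : Val} {n₁ n₂ : ℕ}
      (ha : Evaluates P env a u n₁) (hf : P[f]? = some body)
      (hb : Evaluates P [u] body v n₂) :
      Evaluates P env (.call f a) v (n₁ + n₂ + 1)

/-- Running the first function of `P` on `input` halts with result `output` after `n` steps. -/
def RunsTo (P : Program) (input output : Val) (n : ℕ) : Prop :=
  Evaluates P [input] (.call 0 (.var 0)) output n

/-- Result and step count are determined by the program and its input. -/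
theorem Evaluates.deterministic {P : Program} {env : List Val} {e : Code} {v : Val} {n : ℕ}
    (h : Evaluates P env e v n) :
    ∀ {v' : Val} {n' : ℕ}, Evaluates P env e v' n' → v = v' ∧ n = n' := by
  induction h with
  | var h => intro v' n' h'; cases h'; simp_all
  | const m => intro v' n' h'; cases h'; simp
  | arith ha hb hz iha ihb =>
    intro v' n' h'
    cases h' with
    | arith ha' hb' hz' =>
      obtain ⟨h1, rfl⟩ := iha ha'
      obtain ⟨h2, rfl⟩ := ihb hb'
      cases h1; cases h2
      cases hz <;> cases hz' <;> simp
  | nil => intro v' n' h'; cases h'; simp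
  | cons ha hb iha ihb =>
    intro v' n' h'
    cases h' with
    | cons ha' hb' =>
      obtain ⟨rfl, rfl⟩ := iha ha'
      obtain ⟨rfl, rfl⟩ := ihb hb'
      simp
  | head ha iha =>
    intro v' n' h'
    cases h' with
    | head ha' => obtain ⟨h1, rfl⟩ := iha ha'; cases h1; simp
  | tail ha iha =>
    intro v' n' h'
    cases h' with
    | tail ha' => obtain ⟨h1, rfl⟩ := iha ha'; cases h1; simp
  | letIn ha hb iha ihb =>
    intro v' n' h'
    cases h' with
    | letIn ha' hb' =>
      obtain ⟨rfl, rfl⟩ := iha ha'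
      obtain ⟨rfl, rfl⟩ := ihb hb'
      simp
  | ifNil_nil ha hb iha ihb =>
    intro v' n' h'
    cases h' with
    | ifNil_nil ha' hb' =>
      obtain ⟨-, rfl⟩ := iha ha'
      obtain ⟨rfl, rfl⟩ := ihb hb'
      simp
    | ifNil_cons ha' hb' => exact absurd (iha ha').1 (by simp)
  | ifNil_cons ha hb iha ihb =>
    intro v' n' h'
    cases h' with
    | ifNil_nil ha' hb' => exact absurd (iha ha').1 (by simp)
    | ifNil_cons ha' hb' =>
      obtain ⟨-, rfl⟩ := iha ha'
      obtain ⟨rfl, rfl⟩ := ihb hb'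
      simp
  | ifLe_true ha hb hxy hc iha ihb ihc =>
    intro v' n' h'
    cases h' with
    | ifLe_true ha' hb' hxy' hc' =>
      obtain ⟨-, rfl⟩ := iha ha'
      obtain ⟨-, rfl⟩ := ihb hb'
      obtain ⟨rfl, rfl⟩ := ihc hc'
      simp
    | ifLe_false ha' hb' hxy' hc' =>
      have h1 := (iha ha').1
      have h2 := (ihb hb').1
      cases h1; cases h2
      exact absurd hxy (not_le.mpr hxy')
  | ifLe_false ha hb hxy hc iha ihb ihc =>
    intro v' n' h'
    cases h' with
    | ifLe_true ha' hb' hxy' hc' =>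
      have h1 := (iha ha').1
      have h2 := (ihb hb').1
      cases h1; cases h2
      exact absurd hxy' (not_le.mpr hxy)
    | ifLe_false ha' hb' hxy' hc' =>
      obtain ⟨-, rfl⟩ := iha ha'
      obtain ⟨-, rfl⟩ := ihb hb'
      obtain ⟨rfl, rfl⟩ := ihc hc'
      simp
  | call ha hf hb iha ihb =>
    intro v' n' h'
    cases h' with
    | call ha' hf' hb' =>
      obtain ⟨rfl, rfl⟩ := iha ha'
      rw [hf] at hf'
      cases hf'
      obtain ⟨rfl, rfl⟩ := ihb hb'
      simp

/-! ## Input and output of the test -/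

/-- The list of the given data. -/
def Val.ofList : List Val → Val
  | [] => .nil
  | v :: l => .cons v (Val.ofList l)

/-- A task as the list of its three parameters. -/
def encodeTask (x : SporadicTask) : Val :=
  Val.ofList [.real x.C, .real x.T, .real x.D]

/-- The input of the test for task `k`: the number of processors, task `k`, and the list of the
higher-priority tasks, in the order of their priorities (not sorted by periods). -/
def encodeInput {N : ℕ} (M : ℕ) (τ : Fin N → SporadicTask) (k : Fin N) : Val :=
  Val.ofList [.real M, encodeTask (τ k),
    Val.ofList (List.ofFn fun a : Fin (k : ℕ) => encodeTask (τ (a.castLE k.isLt.le)))]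

/-- Truth values as output. -/
def encodeBool (b : Bool) : Val :=
  .real (if b then 1 else 0)

end GlobalFP

/-! Suppose that a job of task `k` misses its deadline although the earlier jobs of its task met
theirs. It executes whenever fewer than M higher-priority tasks do, so unsaturated time is less than
the fraction Δ = `DeltaMax τ k` of the window from its release to its deadline. Among this release
and the earlier higher-priority releases, let t be the earliest point from which the window up to
the deadline still has this property, and let L be its length (`exists_window_start`). By
minimality, a higher-priority task j backlogged since s < t has executed for at least Δ(t - s) ≥
U_j(t - s) before t. Its execution in the first y units of the window is therefore at most U_j θ_j,
plus C_j once y > θ_j, where θ_j stands for the offset of its last release (`exists_last_release`).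

On the other hand, each prefix of length y contains less than ΔL unsaturated time, so the total
execution in it exceeds M(y - ΔL). Taking y = θ_j, weighting by U_j and summing, and combining with
y = L, eliminates ∑ U_j θ_j. There remains a sum over pairs of tasks, each contributing U_j C_i or
U_i C_j according to the order of the θ's. The smaller product is the one with the larger period in
the denominator, so the worst order is by periods (`pairForm_le`), and this contradicts the
quadratic condition (`exists_demand_le`).

For the running time, `pairForm` is symmetric in the tasks, so any enumeration by non-increasing
periods may be used (`quadraticTest_iff`). The program finds one by merge sort and evaluates the
form in one linear pass with suffix sums. -/

namespace GlobalFP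

/-! ### The quadratic form as a symmetric sum over pairs -/

/-- The value of the quadratic form `∑ᵢ Uᵢ ∑_{ℓ ≥ i} C_ℓ` for an enumeration by non-increasing
periods, written without reference to the enumeration. -/
noncomputable def pairForm {ι : Type*} (s : Finset ι) (x : ι → SporadicTask) : ℝ :=
  (∑ i ∈ s, ∑ j ∈ s, (x i).C * (x j).C / max (x i).T (x j).T + ∑ i ∈ s, (x i).C * (x i).U) / 2

theorem SporadicTask.U_pos (x : SporadicTask) : 0 < x.U := div_pos x.C_pos x.T_pos

theorem div_max_eq_of_le {x y : SporadicTask} (h : y.T ≤ x.T) :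
    x.C * y.C / max x.T y.T = x.U * y.C := by
  rw [max_eq_left h, SporadicTask.U]; ring

theorem div_max_eq_of_le' {x y : SporadicTask} (h : y.T ≤ x.T) :
    y.C * x.C / max y.T x.T = x.U * y.C := by
  rw [max_eq_right h, SporadicTask.U]; ring

theorem div_max_le (x y : SporadicTask) : x.C * y.C / max x.T y.T ≤ x.U * y.C := by
  rw [SporadicTask.U, div_mul_eq_mul_div]
  have := x.C_pos; have := y.C_pos; have := x.T_pos
  gcongr
  exact le_max_left _ _

theorem div_max_comm (x y : SporadicTask) :
    x.C * y.C / max x.T y.T = y.C * x.C / max y.T x.T := by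
  rw [max_comm, mul_comm]

/-- The quadratic form of an enumeration by non-increasing periods. -/
theorem sum_Ici_eq_pairForm {ι : Type*} [Fintype ι] [LinearOrder ι] [LocallyFiniteOrderTop ι]
    (x : ι → SporadicTask) (hx : Antitone fun a => (x a).T) :
    ∑ a, (x a).U * ∑ b ∈ Finset.Ici a, (x b).C = pairForm Finset.univ x := by
  have h1 : ∑ a, (x a).U * ∑ b ∈ Finset.Ici a, (x b).C
      = ∑ a, ∑ b, if a ≤ b then (x a).U * (x b).C else 0 := by
    refine Finset.sum_congr rfl fun a _ => ?_
    rw [Finset.mul_sum, ← Finset.sum_filter]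
    congr 1
    ext b; simp
  have h2 : ∑ a, ∑ b, (if a ≤ b then (x a).U * (x b).C else 0)
      = ∑ a, ∑ b, if b ≤ a then (x b).U * (x a).C else 0 := Finset.sum_comm
  have h3 : ∑ a, (x a).C * (x a).U = ∑ a, ∑ b, if a = b then (x a).C * (x a).U else 0 := by
    simp
  rw [h1, pairForm, eq_div_iff two_ne_zero, mul_two]
  -- With one copy transposed, each off-diagonal entry has exactly one orientation present, while
  -- the diagonal occurs twice; hence the extra diagonal sum in `pairForm`.
  nth_rewrite 2 [h2]
  rw [h3]
  simp only [← Finset.sum_add_distrib]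
  refine Finset.sum_congr rfl fun a _ => Finset.sum_congr rfl fun b _ => ?_
  rcases lt_trichotomy a b with h | h | h
  · simp [h.le, h.not_ge, h.ne, div_max_eq_of_le (hx h.le)]
  · subst h
    simp [SporadicTask.U]; ring
  · simp [h.le, h.not_ge, h.ne', div_max_eq_of_le' (hx h.le)]

/-- However the pairs of distinct tasks are oriented, the resulting quadratic form is at least the
one of the enumeration by non-increasing periods. -/
theorem pairForm_le {ι : Type*} (s : Finset ι) (x : ι → SporadicTask) (t : ι → ℝ) :
    pairForm s x ≤ ∑ j ∈ s, ∑ i ∈ s, if t j ≤ t i then (x j).U * (x i).C else 0 := by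
  classical
  have h2 : ∑ j ∈ s, ∑ i ∈ s, (if t j ≤ t i then (x j).U * (x i).C else 0)
      = ∑ j ∈ s, ∑ i ∈ s, (if t i ≤ t j then (x i).U * (x j).C else 0) := Finset.sum_comm
  have h3 : ∑ a ∈ s, (x a).C * (x a).U
      = ∑ a ∈ s, ∑ b ∈ s, if a = b then (x a).C * (x a).U else 0 :=
    Finset.sum_congr rfl fun a ha => by simp [ha]
  rw [pairForm, div_le_iff₀ two_pos, mul_two]
  -- With one copy transposed, the entry at `(a, b)` holds both orientations of the pair. At least
  -- one of them is counted, and each is at least `C * C / max T T`.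
  nth_rewrite 2 [h2]
  rw [h3]
  simp only [← Finset.sum_add_distrib]
  refine Finset.sum_le_sum fun a _ => Finset.sum_le_sum fun b _ => ?_
  rcases eq_or_ne a b with rfl | hab
  · simp [SporadicTask.U]; apply le_of_eq; ring
  have p1 := mul_pos (x a).U_pos (x b).C_pos
  have p2 := mul_pos (x b).U_pos (x a).C_pos
  have q1 := div_max_le (x a) (x b)
  have q2 := div_max_comm (x a) (x b) ▸ div_max_le (x b) (x a)
  rw [if_neg hab, add_zero]
  rcases le_total (t a) (t b) with h | h
  · rw [if_pos h]
    split_ifs <;> linarith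
  · rw [if_pos h]
    split_ifs <;> linarith

/-- A constant `t` counts both orientations of every pair, which gives the full product. -/
theorem pairForm_le_mul {ι : Type*} (s : Finset ι) (x : ι → SporadicTask) :
    pairForm s x ≤ (∑ j ∈ s, (x j).U) * ∑ i ∈ s, (x i).C := by
  refine (pairForm_le s x fun _ => 0).trans (le_of_eq ?_)
  simp [Finset.sum_mul_sum]

theorem sum_equiv_Iio {N : ℕ} (k : Fin N) (σ : Fin (k : ℕ) ≃ {i : Fin N // i < k})
    (f : Fin N → ℝ) : ∑ a, f (σ a) = ∑ i ∈ Finset.Iio k, f i := by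
  rw [Equiv.sum_comp σ (fun i => f i)]
  rw [← Finset.sum_subtype (Finset.Iio k) (p := fun i => i < k) (by simp) f]

theorem pairForm_equiv_Iio {N : ℕ} (τ : Fin N → SporadicTask) (k : Fin N)
    (σ : Fin (k : ℕ) ≃ {i : Fin N // i < k}) :
    pairForm Finset.univ (fun a => τ (σ a)) = pairForm (Finset.Iio k) τ := by
  rw [pairForm, pairForm, sum_equiv_Iio k σ (fun i => (τ i).C * (τ i).U)]
  have h : ∀ i, ∑ a, (τ i).C * (τ (σ a)).C / max (τ i).T (τ (σ a)).T
      = ∑ j ∈ Finset.Iio k, (τ i).C * (τ j).C / max (τ i).T (τ j).T := fun i =>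
    sum_equiv_Iio k σ (fun j => (τ i).C * (τ j).C / max (τ i).T (τ j).T)
  simp only [h]
  rw [sum_equiv_Iio k σ (fun i => ∑ j ∈ Finset.Iio k, (τ i).C * (τ j).C / max (τ i).T (τ j).T)]

theorem exists_equiv_antitone {N : ℕ} (k : Fin N) (f : Fin N → ℝ) :
    ∃ σ : Fin (k : ℕ) ≃ {i : Fin N // i < k}, Antitone fun a => f (σ a) := by
  have hc : Fintype.card {i : Fin N // i < k} = k := by
    rw [Fintype.card_of_subtype (Finset.Iio k) (by simp), Fin.card_Iio]
  let e := (Fintype.equivFinOfCardEq hc).symm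
  refine ⟨(Tuple.sort fun a => - f (e a)).trans e, fun a b hab => ?_⟩
  have := Tuple.monotone_sort (fun a => - f (e a)) hab
  simpa using this

/-- The quadratic test without reference to an enumeration. -/
theorem quadraticTest_iff {N : ℕ} (M : ℕ) (τ : Fin N → SporadicTask) (k : Fin N) :
    QuadraticTest M τ k ↔
      (∑ i ∈ Finset.Iio k, (τ i).U) + (τ k).U ≤ M ∧
      (∑ i ∈ Finset.Iio k, (τ i).C) / (τ k).D ≤ M ∧
      DeltaMax τ k ≤
        1 - 1 / (M : ℝ) * (∑ i ∈ Finset.Iio k, (τ i).U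
          + (∑ i ∈ Finset.Iio k, (τ i).C) / (τ k).D)
        + 1 / (M : ℝ) ^ 2 * (pairForm (Finset.Iio k) τ / (τ k).D) := by
  have hU : ∑ i ∈ Finset.Iic k, (τ i).U = (∑ i ∈ Finset.Iio k, (τ i).U) + (τ k).U := by
    rw [← Finset.Iio_insert, Finset.sum_insert (by simp), add_comm]
  have hC : ∑ i ∈ Finset.Iio k, (τ i).C / (τ k).D = (∑ i ∈ Finset.Iio k, (τ i).C) / (τ k).D :=
    (Finset.sum_div _ _ _).symm
  have key : ∀ σ : Fin (k : ℕ) ≃ {i : Fin N // i < k}, Antitone (fun a => (τ (σ a)).T) →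
      1 - 1 / (M : ℝ) * ∑ a, ((τ (σ a)).U + (τ (σ a)).C / (τ k).D)
        + 1 / (M : ℝ) ^ 2 * ∑ a, (τ (σ a)).U * ∑ b ∈ Finset.Ici a, (τ (σ b)).C / (τ k).D =
      1 - 1 / (M : ℝ) * (∑ i ∈ Finset.Iio k, (τ i).U
          + (∑ i ∈ Finset.Iio k, (τ i).C) / (τ k).D)
        + 1 / (M : ℝ) ^ 2 * (pairForm (Finset.Iio k) τ / (τ k).D) := by
    intro σ hσ
    rw [sum_equiv_Iio k σ (fun i => (τ i).U + (τ i).C / (τ k).D), Finset.sum_add_distrib, hC,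
      ← pairForm_equiv_Iio τ k σ, ← sum_Ici_eq_pairForm _ hσ, Finset.sum_div]
    simp only [← Finset.sum_div, ← mul_div_assoc]
  constructor
  · rintro ⟨h1, h2, σ, hσ, h3⟩
    exact ⟨hU ▸ h1, hC ▸ h2, key σ hσ ▸ h3⟩
  · rintro ⟨h1, h2, h3⟩
    obtain ⟨σ, hσ⟩ := exists_equiv_antitone k (fun i => (τ i).T)
    exact ⟨hU ▸ h1, hC ▸ h2, σ, hσ, (key σ hσ).symm ▸ h3⟩

theorem deltaMax_le_iff {N : ℕ} (τ : Fin N → SporadicTask) (k : Fin N) (R : ℝ) :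
    DeltaMax τ k ≤ R ↔ (τ k).C / (τ k).D ≤ R ∧ ∀ j < k, (τ j).U ≤ R := by
  simp [DeltaMax, Finset.fold_max_le]

/-! ### The decision program: merge sort and a linear pass -/

/-- Distributes the elements of a list alternately to two lists. -/
def splitCode : Code :=
  .ifNil (.var 0) (.cons .nil .nil)
    (.letIn (.call 1 (.tail (.var 0)))
      (.cons (.cons (.head (.var 1)) (.tail (.var 0))) (.head (.var 0))))

/-- Merges two lists of tasks that are sorted by non-increasing periods. -/
def mergeCode : Code :=
  .ifNil (.head (.var 0)) (.tail (.var 0))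
    (.ifNil (.tail (.var 0)) (.head (.var 0))
      (.ifLe (.head (.tail (.head (.tail (.var 0))))) (.head (.tail (.head (.head (.var 0)))))
        (.cons (.head (.head (.var 0)))
          (.call 2 (.cons (.tail (.head (.var 0))) (.tail (.var 0)))))
        (.cons (.head (.tail (.var 0)))
          (.call 2 (.cons (.head (.var 0)) (.tail (.tail (.var 0))))))))

/-- Merge sort of a list of tasks by non-increasing periods. -/
def sortCode : Code :=
  .ifNil (.var 0) .nil
    (.ifNil (.tail (.var 0)) (.var 0)
      (.letIn (.call 1 (.var 0))
        (.call 2 (.cons (.call 3 (.head (.var 0))) (.call 3 (.tail (.var 0)))))))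

/-- The total utilization, the total execution time, the quadratic form and the maximal utilization
of a list of tasks. -/
def sumsCode : Code :=
  .ifNil (.var 0) (.cons (.const 0) (.cons (.const 0) (.cons (.const 0) (.const 0))))
    (.letIn (.call 4 (.tail (.var 0)))
      (.letIn (.arith .div (.head (.head (.var 1))) (.head (.tail (.head (.var 1)))))
        (.letIn (.arith .add (.head (.tail (.var 1))) (.head (.head (.var 2))))
          (.cons (.arith .add (.head (.var 2)) (.var 1))
            (.cons (.var 0)
              (.cons (.arith .add (.head (.tail (.tail (.var 2)))) (.arith .mul (.var 1) (.var 0)))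
                (.ifLe (.tail (.tail (.tail (.var 2)))) (.var 1) (.var 1)
                  (.tail (.tail (.tail (.var 2)))))))))))

/-- The comparisons of the quadratic test, for the bound on `Δ_k^max`, the sums over the tasks of
higher priority, and the input. -/
def decisionCode : Code :=
  .ifLe
    (.arith .add (.head (.var 1))
      (.arith .div (.head (.head (.tail (.var 2)))) (.head (.tail (.head (.tail (.var 2)))))))
    (.head (.var 2))
    (.ifLe
      (.arith .div (.head (.tail (.var 1))) (.head (.tail (.tail (.head (.tail (.var 2)))))))
      (.head (.var 2))
      (.ifLe
        (.arith .div (.head (.head (.tail (.var 2))))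
          (.head (.tail (.tail (.head (.tail (.var 2)))))))
        (.var 0)
        (.ifLe (.tail (.tail (.tail (.var 1)))) (.var 0) (.const 1) (.const 0))
        (.const 0))
      (.const 0))
    (.const 0)

/-- The bound on `Δ_k^max`, for the sums over the tasks of higher priority and the input. -/
def boundCode : Code :=
  .arith .add
    (.arith .sub (.const 1)
      (.arith .mul (.arith .div (.const 1) (.head (.var 1)))
        (.arith .add (.head (.var 0))
          (.arith .div (.head (.tail (.var 0))) (.head (.tail (.tail (.head (.tail (.var 1))))))))))
    (.arith .mul (.arith .div (.const 1) (.arith .mul (.head (.var 1)) (.head (.var 1))))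
      (.arith .div (.head (.tail (.tail (.var 0))))
        (.head (.tail (.tail (.head (.tail (.var 1))))))))

/-- The quadratic test. -/
def testCode : Code :=
  .letIn (.call 4 (.call 3 (.head (.tail (.tail (.var 0))))))
    (.letIn boundCode decisionCode)

/-- The program that decides the quadratic test. -/
def testProgram : Program := [testCode, splitCode, mergeCode, sortCode, sumsCode]

/-! ### Correctness and step counts of the program -/

/-- A list of tasks as a datum. -/
def encodeTasks (l : List SporadicTask) : Val := Val.ofList (l.map encodeTask)

theorem Evaluates.cast {P : Program} {env : List Val} {e : Code} {v v' : Val} {n n' : ℕ}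
    (h : Evaluates P env e v n) (hv : v = v') (hn : n = n') : Evaluates P env e v' n' := by
  subst hv hn; exact h

theorem split_evaluates (l : List SporadicTask) :
    ∃ l₁ l₂ : List SporadicTask, (l₁ ++ l₂).Perm l ∧ l₁.length = (l.length + 1) / 2 ∧
      l₂.length = l.length / 2 ∧
      Evaluates testProgram [encodeTasks l] splitCode
        (.cons (encodeTasks l₁) (encodeTasks l₂)) (14 * l.length + 5) := by
  induction l with
  | nil =>
    exact ⟨[], [], by simp, by simp, by simp,
      (Evaluates.ifNil_nil (.var rfl) (.cons .nil .nil)).cast rfl rfl⟩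
  | cons x l ih =>
    obtain ⟨l₁, l₂, hp, h₁, h₂, he⟩ := ih
    -- The halves swap roles, so the new element always joins the one that is not longer.
    refine ⟨x :: l₂, l₁, ?_, by simp [h₂]; omega, by simp [h₁], ?_⟩
    · simpa using List.perm_append_comm.trans hp
    · refine (Evaluates.ifNil_cons (.var rfl) (.letIn (.call (.tail (.var rfl)) rfl he)
        (.cons (.cons (.head (.var rfl)) (.tail (.var rfl))) (.head (.var rfl))))).cast rfl ?_
      simp; ring

theorem merge_evaluates : ∀ l₁ l₂ : List SporadicTask,
    l₁.Pairwise (fun x y => y.T ≤ x.T) → l₂.Pairwise (fun x y => y.T ≤ x.T) →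
    ∃ (l : List SporadicTask) (n : ℕ), l.Perm (l₁ ++ l₂) ∧ l.Pairwise (fun x y => y.T ≤ x.T) ∧
      n ≤ 40 * (l₁.length + l₂.length) + 20 ∧
      Evaluates testProgram [.cons (encodeTasks l₁) (encodeTasks l₂)] mergeCode (encodeTasks l) n
  | [], l₂, _, h₂ => ⟨l₂, _, by simp, h₂, by omega,
      .ifNil_nil (.head (.var rfl)) (.tail (.var rfl))⟩
  | x :: l₁, [], h₁, _ => ⟨x :: l₁, _, by simp, h₁, by omega,
      .ifNil_cons (.head (.var rfl)) (.ifNil_nil (.tail (.var rfl)) (.head (.var rfl)))⟩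
  | x :: l₁, y :: l₂, h₁, h₂ => by
    rcases le_or_gt y.T x.T with hxy | hxy
    · obtain ⟨l, n, hp, hs, hn, he⟩ := merge_evaluates l₁ (y :: l₂) (List.pairwise_cons.1 h₁).2 h₂
      refine ⟨x :: l, _, by simpa using hp, ?_, ?_, .ifNil_cons (.head (.var rfl))
        (.ifNil_cons (.tail (.var rfl)) (.ifLe_true
          (.head (.tail (.head (.tail (.var rfl))))) (.head (.tail (.head (.head (.var rfl))))) hxy
          (.cons (.head (.head (.var rfl)))
            (.call (.cons (.tail (.head (.var rfl))) (.tail (.var rfl))) rfl he))))⟩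
      · refine List.pairwise_cons.2 ⟨fun z hz => ?_, hs⟩
        rcases List.mem_append.1 (hp.mem_iff.1 hz) with hz | hz
        · exact (List.pairwise_cons.1 h₁).1 z hz
        · rcases List.mem_cons.1 hz with rfl | hz
          · exact hxy
          · exact ((List.pairwise_cons.1 h₂).1 z hz).trans hxy
      · simp at hn ⊢; omega
    · obtain ⟨l, n, hp, hs, hn, he⟩ := merge_evaluates (x :: l₁) l₂ h₁ (List.pairwise_cons.1 h₂).2
      refine ⟨y :: l, _, (hp.cons y).trans List.perm_middle.symm, ?_, ?_,
        .ifNil_cons (.head (.var rfl))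
        (.ifNil_cons (.tail (.var rfl)) (.ifLe_false
          (.head (.tail (.head (.tail (.var rfl))))) (.head (.tail (.head (.head (.var rfl))))) hxy
          (.cons (.head (.tail (.var rfl)))
            (.call (.cons (.head (.var rfl)) (.tail (.tail (.var rfl)))) rfl he))))⟩
      · refine List.pairwise_cons.2 ⟨fun z hz => ?_, hs⟩
        rcases List.mem_append.1 (hp.mem_iff.1 hz) with hz | hz
        · rcases List.mem_cons.1 hz with rfl | hz
          · exact hxy.le
          · exact ((List.pairwise_cons.1 h₁).1 z hz).trans hxy.le
        · exact (List.pairwise_cons.1 h₂).1 z hz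
      · simp at hn ⊢; omega
termination_by l₁ l₂ => l₁.length + l₂.length

/-- Passing to the larger half lowers `Nat.clog 2` by one. Splitting and merging cost 54 steps per
task plus constants, which `100 * m` absorbs for `2 ≤ m`; the linear term pays for singletons. The
bound would be 0 for the empty list, which is therefore excluded. -/
theorem sort_evaluates (l : List SporadicTask) (hl : l ≠ []) :
    ∃ (l' : List SporadicTask) (n : ℕ), l'.Perm l ∧ l'.Pairwise (fun x y => y.T ≤ x.T) ∧
      n ≤ 100 * l.length * Nat.clog 2 l.length + 10 * l.length ∧
      Evaluates testProgram [encodeTasks l] sortCode (encodeTasks l') n := by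
  induction hm : l.length using Nat.strong_induction_on generalizing l with
  | _ m ih =>
  subst hm
  match l, hl with
  | [x], _ => exact ⟨[x], _, .refl _, by simp, by simp,
      .ifNil_cons (.var rfl) (.ifNil_nil (.tail (.var rfl)) (.var rfl))⟩
  | x :: y :: l, _ =>
    obtain ⟨l₁, l₂, hp, h₁, h₂, he⟩ := split_evaluates (x :: y :: l)
    set m := (x :: y :: l).length with hm
    have hm2 : 2 ≤ m := by simp [hm]
    obtain ⟨s₁, n₁, hp₁, hs₁, hn₁, he₁⟩ := ih l₁.length (by omega) l₁
      (by rintro rfl; simp at h₁; omega) rfl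
    obtain ⟨s₂, n₂, hp₂, hs₂, hn₂, he₂⟩ := ih l₂.length (by omega) l₂
      (by rintro rfl; simp at h₂; omega) rfl
    obtain ⟨s, n, hps, hss, hns, hes⟩ := merge_evaluates s₁ s₂ hs₁ hs₂
    refine ⟨s, _, hps.trans ((hp₁.append hp₂).trans hp), hss, ?_,
      .ifNil_cons (.var rfl) (.ifNil_cons (.tail (.var rfl))
        (.letIn (.call (.var rfl) rfl he)
          (.call (.cons (.call (.head (.var rfl)) rfl he₁) (.call (.tail (.var rfl)) rfl he₂))
            rfl hes)))⟩
    have hc : Nat.clog 2 m = Nat.clog 2 ((m + 1) / 2) + 1 :=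
      Nat.clog_of_two_le (by norm_num) hm2
    have hc2 : Nat.clog 2 (m / 2) ≤ Nat.clog 2 ((m + 1) / 2) :=
      Nat.clog_mono_right 2 (by omega)
    rw [hp₁.length_eq, hp₂.length_eq] at hns
    rw [h₁] at hn₁ hns
    rw [h₂] at hn₂ hns
    have hc3 : 100 * (m / 2) * Nat.clog 2 (m / 2) ≤ 100 * (m / 2) * Nat.clog 2 ((m + 1) / 2) :=
      Nat.mul_le_mul_left _ hc2
    have hsum : (m + 1) / 2 + m / 2 = m := by omega
    have hmul : 100 * ((m + 1) / 2) * Nat.clog 2 ((m + 1) / 2) +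
        100 * (m / 2) * Nat.clog 2 ((m + 1) / 2) = 100 * m * Nat.clog 2 ((m + 1) / 2) := by
      rw [← add_mul, ← mul_add, hsum]
    rw [hc, mul_add]
    omega

/-- The quadratic form `∑ᵢ Uᵢ ∑_{ℓ ≥ i} C_ℓ` of a list of tasks. -/
noncomputable def listForm : List SporadicTask → ℝ
  | [] => 0
  | x :: l => listForm l + x.U * ((l.map SporadicTask.C).sum + x.C)

/-- The recursive result already holds the execution time of the suffix, so each task costs a
bounded number of steps. The running maximum starts at 0, hence its description only against bounds
`0 ≤ R`. -/
theorem sums_evaluates (l : List SporadicTask) :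
    ∃ (u c m : ℝ) (n : ℕ), u = (l.map SporadicTask.U).sum ∧ c = (l.map SporadicTask.C).sum ∧
      (∀ R, 0 ≤ R → (m ≤ R ↔ ∀ x ∈ l, x.U ≤ R)) ∧ n ≤ 80 * l.length + 20 ∧
      Evaluates testProgram [encodeTasks l] sumsCode
        (.cons (.real u) (.cons (.real c) (.cons (.real (listForm l)) (.real m)))) n := by
  induction l with
  | nil =>
    exact ⟨0, 0, 0, _, by simp, by simp, fun R hR => by simpa using hR, by simp,
      (Evaluates.ifNil_nil (.var rfl) (.cons (.const 0) (.cons (.const 0)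
        (.cons (.const 0) (.const 0))))).cast (by simp [listForm]) rfl⟩
  | cons x l ih =>
    obtain ⟨u, c, m, n, hu, hc, hm, hn, he⟩ := ih
    subst hu hc
    have hT := x.T_pos.ne'
    rcases le_or_gt m x.U with h | h
    · refine ⟨_, _, _, _, ?_, ?_, ?_, ?_, (Evaluates.ifNil_cons (.var rfl)
        (.letIn (.call (.tail (.var rfl)) rfl he)
        (.letIn (.arith (.head (.head (.var rfl))) (.head (.tail (.head (.var rfl)))) (.div _ _ hT))
        (.letIn (.arith (.head (.tail (.var rfl))) (.head (.head (.var rfl))) (.add _ _))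
        (.cons (.arith (.head (.var rfl)) (.var rfl) (.add _ _))
        (.cons (.var rfl)
        (.cons (.arith (.head (.tail (.tail (.var rfl))))
          (.arith (.var rfl) (.var rfl) (.mul _ _)) (.add _ _))
          (.ifLe_true (.tail (.tail (.tail (.var rfl)))) (.var rfl) h (.var rfl)))))))))⟩
      · simp [SporadicTask.U, add_comm]
      · simp [add_comm]
      · intro R hR
        have := hm R hR
        simp only [List.mem_cons, forall_eq_or_imp]
        rw [← this]
        exact ⟨fun h' => ⟨h', h.trans h'⟩, fun h' => h'.1⟩
      · simp; omega
    · refine ⟨_, _, _, _, ?_, ?_, ?_, ?_, (Evaluates.ifNil_cons (.var rfl)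
        (.letIn (.call (.tail (.var rfl)) rfl he)
        (.letIn (.arith (.head (.head (.var rfl))) (.head (.tail (.head (.var rfl)))) (.div _ _ hT))
        (.letIn (.arith (.head (.tail (.var rfl))) (.head (.head (.var rfl))) (.add _ _))
        (.cons (.arith (.head (.var rfl)) (.var rfl) (.add _ _))
        (.cons (.var rfl)
        (.cons (.arith (.head (.tail (.tail (.var rfl))))
          (.arith (.var rfl) (.var rfl) (.mul _ _)) (.add _ _))
          (.ifLe_false (.tail (.tail (.tail (.var rfl)))) (.var rfl) h
            (.tail (.tail (.tail (.var rfl)))))))))))) ⟩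
      · simp [SporadicTask.U, add_comm]
      · simp [add_comm]
      · intro R hR
        have := hm R hR
        simp only [List.mem_cons, forall_eq_or_imp]
        rw [← this]
        exact ⟨fun h' => ⟨h.le.trans h', h'⟩, fun h' => h'.2⟩
      · simp; omega

/-- The value of the quadratic form of any enumeration of a list of tasks by non-increasing
periods. -/
noncomputable def listPairForm (l : List SporadicTask) : ℝ :=
  ((l.map fun x => (l.map fun y => x.C * y.C / max x.T y.T).sum).sum
    + (l.map fun x => x.C * x.U).sum) / 2

/-- In a sorted list the head has the maximal period in each of its pairs. This passes from the
program's recursion to a form that is invariant under permutation. -/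
theorem listForm_eq_listPairForm (l : List SporadicTask)
    (hl : l.Pairwise (fun x y => y.T ≤ x.T)) : listForm l = listPairForm l := by
  induction l with
  | nil => simp [listForm, listPairForm]
  | cons x l ih =>
    obtain ⟨h, hl⟩ := List.pairwise_cons.1 hl
    have e₁ : (l.map fun y => x.C * y.C / max x.T y.T).sum
        = x.U * (l.map SporadicTask.C).sum := by
      rw [← List.sum_map_mul_left]
      exact congrArg List.sum (List.map_congr_left fun y hy => div_max_eq_of_le (h y hy))
    have e₂ : (l.map fun y => y.C * x.C / max y.T x.T).sum
        = x.U * (l.map SporadicTask.C).sum := by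
      rw [← List.sum_map_mul_left]
      exact congrArg List.sum (List.map_congr_left fun y hy => div_max_eq_of_le' (h y hy))
    have e₃ : x.C * x.C / max x.T x.T = x.C * x.U := by
      rw [max_self, SporadicTask.U]; ring
    rw [listForm, ih hl]
    simp only [listPairForm, List.map_cons, List.sum_cons, List.sum_map_add, e₁, e₂, e₃]
    ring

theorem listPairForm_eq_of_perm {l l' : List SporadicTask} (h : l.Perm l') :
    listPairForm l = listPairForm l' := by
  have e : ∀ x : SporadicTask, (l.map fun y => x.C * y.C / max x.T y.T).sum
      = (l'.map fun y => x.C * y.C / max x.T y.T).sum := fun x => (h.map _).sum_eq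
  simp only [listPairForm, e]
  rw [(h.map _).sum_eq, (h.map fun x => x.C * x.U).sum_eq]

theorem listPairForm_ofFn {n : ℕ} (x : Fin n → SporadicTask) :
    listPairForm (List.ofFn x) = pairForm Finset.univ x := by
  simp [listPairForm, pairForm, List.map_ofFn, List.sum_ofFn]

/-- The enumeration of the tasks of higher priority than `k` by priorities. -/
def priorityEquiv {N : ℕ} (k : Fin N) : Fin (k : ℕ) ≃ {i : Fin N // i < k} where
  toFun a := ⟨a.castLE k.isLt.le, a.isLt⟩
  invFun i := ⟨i.1, i.2⟩
  left_inv _ := rfl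
  right_inv _ := rfl

theorem encodeInput_eq {N : ℕ} (M : ℕ) (τ : Fin N → SporadicTask) (k : Fin N) :
    encodeInput M τ k = .cons (.real M) (.cons (encodeTask (τ k))
      (.cons (encodeTasks (List.ofFn fun a => τ (priorityEquiv k a))) .nil)) := by
  rw [encodeInput, encodeTasks, List.map_ofFn]; rfl

theorem test_runs {N : ℕ} (M : ℕ) (τ : Fin N → SporadicTask) (k : Fin N) (hM : 0 < M)
    (hk : 0 < (k : ℕ)) :
    ∃ (b : Bool) (n : ℕ), RunsTo testProgram (encodeInput M τ k) (encodeBool b) n ∧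
      (b = true ↔ QuadraticTest M τ k) ∧ n ≤ 100 * (k : ℕ) * Nat.clog 2 k + 90 * k + 300 := by
  have hM' : (M : ℝ) ≠ 0 := by positivity
  have hT := (τ k).T_pos.ne'
  have hD := (τ k).D_pos.ne'
  set l := List.ofFn fun a => τ (priorityEquiv k a) with hl
  have hlen : l.length = k := by simp [hl]
  obtain ⟨s, n₁, hps, hss, hn₁, he₁⟩ := sort_evaluates l (by rintro h; simp [h] at hlen; omega)
  obtain ⟨u, c, m, n₂, hu, hc, hm, hn₂, he₂⟩ := sums_evaluates s
  rw [hps.length_eq, hlen] at hn₂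
  rw [hlen] at hn₁
  rw [(hps.map _).sum_eq, hl, List.map_ofFn, List.sum_ofFn] at hu hc
  rw [listForm_eq_listPairForm s hss, listPairForm_eq_of_perm hps, hl, listPairForm_ofFn,
    pairForm_equiv_Iio] at he₂
  have hu' : u = ∑ i ∈ Finset.Iio k, (τ i).U := hu.trans (sum_equiv_Iio k _ fun i => (τ i).U)
  have hc' : c = ∑ i ∈ Finset.Iio k, (τ i).C := hc.trans (sum_equiv_Iio k _ fun i => (τ i).C)
  have hm' : ∀ R, 0 ≤ R → (m ≤ R ↔ ∀ j < k, (τ j).U ≤ R) := by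
    intro R hR
    rw [hm R hR]
    constructor
    · intro h j hj
      refine h _ (hps.mem_iff.2 ?_)
      rw [hl, List.mem_ofFn]
      exact ⟨(priorityEquiv k).symm ⟨j, hj⟩, by simp⟩
    · intro h x hx
      obtain ⟨a, rfl⟩ := (List.mem_ofFn' _ _).1 (hps.mem_iff.1 hx)
      exact h _ (priorityEquiv k a).2
  set q := pairForm (Finset.Iio k) τ
  set R := 1 - 1 / (M : ℝ) * (u + c / (τ k).D) + 1 / ((M : ℝ) * M) * (q / (τ k).D) with hR
  have htest : QuadraticTest M τ k ↔ u + (τ k).C / (τ k).T ≤ M ∧ c / (τ k).D ≤ M ∧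
      (τ k).C / (τ k).D ≤ R ∧ m ≤ R := by
    rw [quadraticTest_iff, deltaMax_le_iff, hR, hu', hc', ← hu', ← hc', pow_two]
    refine and_congr_right fun _ => and_congr_right fun _ => and_congr_right fun h => ?_
    -- The bound is at least `C_k / D_k > 0` here, so starting the maximum at 0 does no harm.
    exact (hm' _ ((div_pos (τ k).C_pos (τ k).D_pos).le.trans h)).symm
  rw [encodeInput_eq]
  suffices h : ∃ (b : Bool) (n : ℕ), (b = true ↔ u + (τ k).C / (τ k).T ≤ M ∧
      c / (τ k).D ≤ M ∧ (τ k).C / (τ k).D ≤ R ∧ m ≤ R) ∧ n ≤ 60 ∧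
      Evaluates testProgram [.real R, .cons (.real u) (.cons (.real c) (.cons (.real q) (.real m))),
        .cons (.real M) (.cons (encodeTask (τ k)) (.cons (encodeTasks l) .nil))]
        decisionCode (encodeBool b) n by
    obtain ⟨b, n, hb, hn, he⟩ := h
    have v : ∃ n', n' ≤ 60 ∧ Evaluates testProgram
        [.cons (.real u) (.cons (.real c) (.cons (.real q) (.real m))),
          .cons (.real M) (.cons (encodeTask (τ k)) (.cons (encodeTasks l) .nil))]
        boundCode (.real R) n' :=
      ⟨_, by norm_num, (Evaluates.arith
        (.arith (.const 1) (.arith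
          (.arith (.const 1) (.head (.var rfl)) (.div _ _ hM'))
          (.arith (.head (.var rfl)) (.arith (.head (.tail (.var rfl)))
            (.head (.tail (.tail (.head (.tail (.var rfl)))))) (.div _ _ hD)) (.add _ _))
          (.mul _ _)) (.sub _ _))
        (.arith (.arith (.const 1) (.arith (.head (.var rfl)) (.head (.var rfl)) (.mul _ _))
            (.div _ _ (mul_ne_zero hM' hM')))
          (.arith (.head (.tail (.tail (.var rfl))))
            (.head (.tail (.tail (.head (.tail (.var rfl)))))) (.div _ _ hD)) (.mul _ _))
        (.add _ _)).cast (by simp [hR]) rfl⟩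
    obtain ⟨n', hn', v⟩ := v
    exact ⟨b, _, .call (.var rfl) rfl (.letIn (.call (.call (.head (.tail (.tail (.var rfl))))
      rfl he₁) rfl he₂) (.letIn v he)), hb.trans htest.symm, by omega⟩
  have e₀ : Val.real ((0 : ℕ) : ℝ) = encodeBool false := by simp [encodeBool]
  have e₁ : Val.real ((1 : ℕ) : ℝ) = encodeBool true := by simp [encodeBool]
  have v₁ := Evaluates.arith (P := testProgram) (env := [.real R,
      .cons (.real u) (.cons (.real c) (.cons (.real q) (.real m))),
      .cons (.real M) (.cons (encodeTask (τ k)) (.cons (encodeTasks l) .nil))])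
      (.head (.var (i := 1) rfl)) (.arith (.head (.head (.tail (.var (i := 2) rfl))))
        (.head (.tail (.head (.tail (.var (i := 2) rfl))))) (.div _ _ hT)) (.add _ _)
  have v₂ := Evaluates.arith (P := testProgram) (env := [.real R,
      .cons (.real u) (.cons (.real c) (.cons (.real q) (.real m))),
      .cons (.real M) (.cons (encodeTask (τ k)) (.cons (encodeTasks l) .nil))])
      (.head (.tail (.var (i := 1) rfl)))
      (.head (.tail (.tail (.head (.tail (.var (i := 2) rfl)))))) (.div _ _ hD)
  have v₃ := Evaluates.arith (P := testProgram) (env := [.real R,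
      .cons (.real u) (.cons (.real c) (.cons (.real q) (.real m))),
      .cons (.real M) (.cons (encodeTask (τ k)) (.cons (encodeTasks l) .nil))])
      (.head (.head (.tail (.var (i := 2) rfl))))
      (.head (.tail (.tail (.head (.tail (.var (i := 2) rfl)))))) (.div _ _ hD)
  rcases lt_or_ge (M : ℝ) (u + (τ k).C / (τ k).T) with h₁ | h₁
  · exact ⟨false, _, by simp [h₁.not_ge], by norm_num,
      (Evaluates.ifLe_false v₁ (.head (.var rfl)) h₁ (.const 0)).cast e₀ rfl⟩
  rcases lt_or_ge (M : ℝ) (c / (τ k).D) with h₂ | h₂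
  · exact ⟨false, _, by simp [h₂.not_ge], by norm_num,
      (Evaluates.ifLe_true v₁ (.head (.var rfl)) h₁
        (.ifLe_false v₂ (.head (.var rfl)) h₂ (.const 0))).cast e₀ rfl⟩
  rcases lt_or_ge R ((τ k).C / (τ k).D) with h₃ | h₃
  · exact ⟨false, _, by simp [h₃.not_ge], by norm_num,
      (Evaluates.ifLe_true v₁ (.head (.var rfl)) h₁
        (.ifLe_true v₂ (.head (.var rfl)) h₂
        (.ifLe_false v₃ (.var rfl) h₃ (.const 0)))).cast e₀ rfl⟩
  rcases lt_or_ge R m with h₄ | h₄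
  · exact ⟨false, _, by simp [h₄.not_ge], by norm_num,
      (Evaluates.ifLe_true v₁ (.head (.var rfl)) h₁
        (.ifLe_true v₂ (.head (.var rfl)) h₂
        (.ifLe_true v₃ (.var rfl) h₃
        (.ifLe_false (.tail (.tail (.tail (.var rfl)))) (.var rfl) h₄ (.const 0))))).cast e₀ rfl⟩
  · exact ⟨true, _, by simp [h₁, h₂, h₃, h₄], by norm_num,
      (Evaluates.ifLe_true v₁ (.head (.var rfl)) h₁
        (.ifLe_true v₂ (.head (.var rfl)) h₂
        (.ifLe_true v₃ (.var rfl) h₃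
        (.ifLe_true (.tail (.tail (.tail (.var rfl)))) (.var rfl) h₄ (.const 1))))).cast e₁ rfl⟩

/-- Since `log (k + 1) ≥ log 2 > 1/2`, all additive constants and linear terms are absorbed into
multiples of the logarithm. -/
theorem clog_bound (k : ℕ) (hk : 0 < k) :
    ((100 * k * Nat.clog 2 k + 90 * k + 300 : ℕ) : ℝ) ≤
      2000 * (((k : ℝ) + 1) * Real.log ((k : ℝ) + 1)) := by
  have hk1 : (1 : ℝ) ≤ k := by exact_mod_cast hk
  have hlog2 : 1 / 2 < Real.log 2 := by linarith [Real.log_two_gt_d9]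
  have hlog : Real.log 2 ≤ Real.log (k + 1) := Real.log_le_log two_pos (by linarith)
  have hclog : (Nat.clog 2 k : ℝ) ≤ 4 * Real.log (k + 1) := by
    have h := (Nat.ceil_lt_add_one (Real.logb_nonneg one_lt_two hk1)).le
    rw [show (2 : ℝ) = ((2 : ℕ) : ℝ) by norm_num, Real.natCeil_logb_natCast] at h
    have h2 : Real.logb (2 : ℕ) k ≤ 2 * Real.log (k + 1) := by
      rw [Real.logb, Nat.cast_ofNat, div_le_iff₀ (by linarith)]
      have : Real.log k ≤ Real.log (k + 1) := Real.log_le_log (by linarith) (by linarith)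
      nlinarith
    linarith
  push_cast
  have h1 : (k : ℝ) * Nat.clog 2 k ≤ k * (4 * Real.log (k + 1)) :=
    mul_le_mul_of_nonneg_left hclog (by linarith)
  nlinarith

/-! ## Occupied time -/

/-- The length of the part of `[a, b)` that lies in `A`. -/
noncomputable def occ (A : Set ℝ) (a b : ℝ) : ℝ := MeasureTheory.volume.real (A ∩ Set.Ico a b)

theorem volume_inter_Ico_ne_top (A : Set ℝ) (a b : ℝ) :
    MeasureTheory.volume (A ∩ Set.Ico a b) ≠ ⊤ :=
  ((MeasureTheory.measure_mono Set.inter_subset_right).trans_lt (by simp)).ne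

theorem occ_nonneg (A : Set ℝ) (a b : ℝ) : 0 ≤ occ A a b := MeasureTheory.measureReal_nonneg

theorem occ_self (A : Set ℝ) (a : ℝ) : occ A a a = 0 := by simp [occ]

theorem occ_le_occ {A B : Set ℝ} {a b : ℝ} (h : ∀ t ∈ A, a ≤ t → t < b → t ∈ B) :
    occ A a b ≤ occ B a b :=
  MeasureTheory.measureReal_mono (fun t ht => ⟨h t ht.1 ht.2.1 ht.2.2, ht.2⟩)
    (volume_inter_Ico_ne_top _ _ _)

theorem occ_le {a b : ℝ} (A : Set ℝ) (h : a ≤ b) : occ A a b ≤ b - a := by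
  have : occ A a b ≤ MeasureTheory.volume.real (Set.Ico a b) :=
    MeasureTheory.measureReal_mono Set.inter_subset_right (by simp)
  simpa [h] using this

theorem occ_add {a b c : ℝ} (A : Set ℝ) (hab : a ≤ b) (hbc : b ≤ c) :
    occ A a b + occ A b c = occ A a c := by
  have h := MeasureTheory.measureReal_inter_add_sdiff (μ := MeasureTheory.volume)
    (s := A ∩ Set.Ico a c) (t := Set.Iio b) measurableSet_Iio (volume_inter_Ico_ne_top _ _ _)
  rw [occ, occ, occ, ← h]
  congr 2
  · ext t
    simp only [Set.mem_inter_iff, Set.mem_Ico, Set.mem_Iio]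
    exact ⟨fun ⟨h, h1, h2⟩ => ⟨⟨h, h1, h2.trans_le hbc⟩, h2⟩, fun ⟨⟨h, h1, _⟩, h2⟩ => ⟨h, h1, h2⟩⟩
  · ext t
    simp only [Set.mem_inter_iff, Set.mem_Ico, Set.mem_Iio, Set.mem_sdiff, not_lt]
    exact ⟨fun ⟨h, h1, h2⟩ => ⟨⟨h, hab.trans h1, h2⟩, h1⟩, fun ⟨⟨h, _, h2⟩, h1⟩ => ⟨h, h1, h2⟩⟩

theorem occ_mono_right {a b c : ℝ} (A : Set ℝ) (hab : a ≤ b) (hbc : b ≤ c) :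
    occ A a b ≤ occ A a c := by
  linarith [occ_add A hab hbc, occ_nonneg A b c]

theorem occ_add_occ_compl {A : Set ℝ} (hA : MeasurableSet A) {a b : ℝ} (h : a ≤ b) :
    occ A a b + occ Aᶜ a b = b - a := by
  have := MeasureTheory.measureReal_inter_add_sdiff (μ := MeasureTheory.volume)
    (s := Set.Ico a b) (t := A) hA (by simp)
  rw [Real.volume_real_Ico_of_le h] at this
  rw [← this, occ, occ, Set.inter_comm, Set.inter_comm Aᶜ, Set.sdiff_eq]

/-- A set that is left as soon as it has been occupied for time `e` is occupied for time at most
`e`. -/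
theorem occ_le_of_forall_lt {A : Set ℝ} {r e : ℝ} (he : 0 ≤ e)
    (h : ∀ t ∈ A, r ≤ t → occ A r t < e) (b : ℝ) : occ A r b ≤ e := by
  rcases le_or_gt r b with hb | hb
  swap
  · simpa [occ, Set.Ico_eq_empty_of_le hb.le] using he
  by_contra! hlt
  -- The supremum of these times is attained, as `occ A r` is 1-Lipschitz in its right end.
  set S := {t | r ≤ t ∧ t ≤ b ∧ occ A r t ≤ e} with hS
  have hne : S.Nonempty := ⟨r, le_rfl, hb, by rw [occ_self]; exact he⟩
  have hbdd : BddAbove S := ⟨b, fun t ht => ht.2.1⟩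
  have hrc : r ≤ sSup S := le_csSup hbdd ⟨le_rfl, hb, by rw [occ_self]; exact he⟩
  have hcb : sSup S ≤ b := csSup_le hne fun t ht => ht.2.1
  have hc : occ A r (sSup S) ≤ e := by
    refine le_of_forall_pos_le_add fun δ hδ => ?_
    obtain ⟨t, ht, hlt⟩ := exists_lt_of_lt_csSup hne (sub_lt_self (sSup S) hδ)
    have h1 := occ_add A ht.1 (le_csSup hbdd ht)
    have h2 := occ_le A (le_csSup hbdd ht)
    linarith [ht.2.2]
  have h0 : occ A (sSup S) b = 0 := by
    -- A point of `A` beyond the supremum would itself lie in `S`; only the null set `{sSup S}`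
    -- remains.
    have hsub : A ∩ Set.Ico (sSup S) b ⊆ {sSup S} := by
      rintro t ⟨htA, ht1, ht2⟩
      have ht : t ∈ S := ⟨hrc.trans ht1, ht2.le, (h t htA (hrc.trans ht1)).le⟩
      exact le_antisymm (le_csSup hbdd ht) ht1
    exact le_antisymm ((MeasureTheory.measureReal_mono hsub (by simp)).trans_eq
      (by simp [MeasureTheory.measureReal_def]))
      (occ_nonneg _ _ _)
  linarith [occ_add A hrc hcb]

/-- If at least `m` of the sets `X j` meet at every point of `B`, then they occupy together at least
`m` times as much time as `B`. -/
theorem mul_occ_le_sum_occ {ι : Type*} (s : Finset ι) (X : ι → Set ℝ) {B : Set ℝ}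
    (hX : ∀ j, MeasurableSet (X j)) (hB : MeasurableSet B) (m : ℕ)
    (h : ∀ t ∈ B, (m : ℝ) ≤ ∑ j ∈ s, (X j).indicator (fun _ => (1 : ℝ)) t) (a b : ℝ) :
    m * occ B a b ≤ ∑ j ∈ s, occ (X j) a b := by
  set μ := MeasureTheory.volume.restrict (Set.Ico a b) with hμ
  have : MeasureTheory.IsFiniteMeasure μ := ⟨by simp [hμ]⟩
  have hocc : ∀ A, MeasurableSet A → occ A a b = μ.real A := fun A hA => by
    rw [hμ, MeasureTheory.measureReal_restrict_apply hA, occ]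
  have hint : ∀ A, MeasurableSet A → ∀ c : ℝ,
      MeasureTheory.Integrable (A.indicator fun _ => c) μ := fun A hA c =>
    (MeasureTheory.integrable_const c).indicator hA
  have h1 : (m : ℝ) * occ B a b = ∫ t, B.indicator (fun _ => (m : ℝ)) t ∂μ := by
    rw [MeasureTheory.integral_indicator_const _ hB, hocc B hB, smul_eq_mul, mul_comm]
  have h2 : ∑ j ∈ s, occ (X j) a b
      = ∫ t, ∑ j ∈ s, (X j).indicator (fun _ => (1 : ℝ)) t ∂μ := by
    rw [MeasureTheory.integral_finsetSum s fun j _ => hint _ (hX j) 1]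
    refine Finset.sum_congr rfl fun j _ => ?_
    rw [MeasureTheory.integral_indicator_const _ (hX j), hocc _ (hX j), smul_eq_mul, mul_one]
  rw [h1, h2]
  refine MeasureTheory.integral_mono (hint B hB _)
    (MeasureTheory.integrable_finsetSum s fun j _ => hint _ (hX j) 1) fun t => ?_
  by_cases ht : t ∈ B
  · simpa [ht] using h t ht
  · simpa [ht] using Finset.sum_nonneg fun j _ =>
      Set.indicator_nonneg (fun _ _ => zero_le_one) t

/-! ## Releases and pending jobs -/

section Schedule

variable {N : ℕ} {τ : Fin N → SporadicTask} (J : JobPattern τ)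

/-- Releases are at least a period apart, so the index of the period containing a release, counted
from `s`, determines it. -/
theorem release_injOn (i : Fin N) (s b : ℝ) :
    Set.MapsTo (fun r => ⌊(r - s) / (τ i).T⌋₊) (J.release i ∩ Set.Ico s b)
      (Finset.range ⌈(b - s) / (τ i).T⌉₊) ∧
    Set.InjOn (fun r => ⌊(r - s) / (τ i).T⌋₊) (J.release i ∩ Set.Ico s b) := by
  have hT := (τ i).T_pos
  have hlt : ∀ r ∈ J.release i ∩ Set.Ico s b, ∀ r' ∈ J.release i ∩ Set.Ico s b, r < r' →
      ⌊(r - s) / (τ i).T⌋₊ < ⌊(r' - s) / (τ i).T⌋₊ := by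
    intro r hr r' hr' hrr
    have h := J.separated i r hr.1 r' hr'.1 hrr
    have h0 : 0 ≤ (r - s) / (τ i).T := div_nonneg (sub_nonneg.2 hr.2.1) hT.le
    rw [Nat.lt_iff_add_one_le, ← Nat.floor_add_one h0]
    refine Nat.floor_le_floor ?_
    rw [div_add_one hT.ne']
    gcongr
    linarith
  constructor
  · intro r hr
    rw [Finset.coe_range, Set.mem_Iio]
    have h0 : 0 ≤ (r - s) / (τ i).T := div_nonneg (sub_nonneg.2 hr.2.1) hT.le
    rw [Nat.floor_lt h0]
    refine lt_of_lt_of_le ?_ (Nat.le_ceil _)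
    have := hr.2.2
    gcongr
  · intro r hr r' hr' heq
    rcases lt_trichotomy r r' with h | h | h
    · exact absurd heq (hlt r hr r' hr' h).ne
    · exact h
    · exact absurd heq (hlt r' hr' r hr h).ne'

theorem release_finite_Ico (i : Fin N) (s b : ℝ) : (J.release i ∩ Set.Ico s b).Finite :=
  Set.Finite.of_injOn (release_injOn J i s b).1 (release_injOn J i s b).2 (Finset.finite_toSet _)

theorem ncard_release_Ico_le (i : Fin N) (s b : ℝ) :
    (J.release i ∩ Set.Ico s b).ncard ≤ ⌈(b - s) / (τ i).T⌉₊ := by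
  have h := Set.ncard_le_ncard_of_injOn _ (release_injOn J i s b).1 (release_injOn J i s b).2
    (Finset.finite_toSet _)
  rwa [Set.ncard_coe_finset, Finset.card_range] at h

theorem release_finite_Iic (i : Fin N) (t : ℝ) : (J.release i ∩ Set.Iic t).Finite :=
  (release_finite_Ico J i 0 (t + 1)).subset fun r hr =>
    ⟨hr.1, J.release_nonneg i r hr.1, lt_of_le_of_lt hr.2 (lt_add_one t)⟩

theorem release_countable (i : Fin N) : (J.release i).Countable := by
  have : J.release i = ⋃ n : ℕ, J.release i ∩ Set.Iic (n : ℝ) := by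
    ext r
    simp only [Set.mem_iUnion, Set.mem_inter_iff, Set.mem_Iic, exists_and_left]
    exact ⟨fun h => ⟨h, exists_nat_ge r⟩, fun h => h.1⟩
  rw [this]
  exact Set.countable_iUnion fun n => (release_finite_Iic J i n).countable

variable {J} {run : Fin N → ℝ → Set ℝ}

theorem Pending.anti {i : Fin N} {r t u : ℝ} (h : Pending J run i r t) (hr : r ≤ u) (hu : u ≤ t) :
    Pending J run i r u :=
  ⟨h.1, hr, (occ_mono_right (run i r) hr hu).trans_lt h.2.2⟩

theorem Pending.exists_ready {i : Fin N} {r t : ℝ} (h : Pending J run i r t) :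
    ∃ r', Ready J run i r' t := by
  have hfin : {r' | Pending J run i r' t}.Finite :=
    (release_finite_Iic J i t).subset fun r' hr' => ⟨hr'.1, hr'.2.1⟩
  obtain ⟨r', hr', hmin⟩ := Set.exists_min_image _ id hfin ⟨r, h⟩
  exact ⟨r', hr', fun r'' hlt hp => absurd (hmin r'' hp) (not_le.2 hlt)⟩

/-- The start of the period of uninterrupted backlog of task `i` up to time `t`. -/
theorem exists_backlog_start (i : Fin N) (t : ℝ) :
    ∃ s ≤ t, (s = t ∨ s ∈ J.release i) ∧ (∀ r < s, ¬ Pending J run i r s) ∧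
      ∀ u, s ≤ u → u < t → ∃ r, Ready J run i r u := by
  -- `t` qualifies vacuously. A job released before the earliest candidate and still pending there
  -- would yield an earlier candidate.
  set S := {s | s ≤ t ∧ (s = t ∨ s ∈ J.release i) ∧
    ∀ u, s ≤ u → u < t → ∃ r, Pending J run i r u} with hS
  have hfin : S.Finite := ((release_finite_Iic J i t).insert t).subset fun s hs =>
    hs.2.1.imp id fun h => ⟨h, hs.1⟩
  obtain ⟨s, ⟨hst, hsr, hs⟩, hmin⟩ := Set.exists_min_image S id hfin
    ⟨t, le_rfl, Or.inl rfl, fun u h1 h2 => absurd h1 (not_le.2 h2)⟩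
  refine ⟨s, hst, hsr, fun r hr hp => ?_, fun u h1 h2 => (hs u h1 h2).elim fun r h => h.exists_ready⟩
  refine absurd (hmin r ⟨hr.le.trans hst, Or.inr hp.1, fun u h1 h2 => ?_⟩) (not_le.2 hr)
  rcases le_total u s with h | h
  · exact ⟨r, hp.anti h1 h⟩
  · exact hs u h h2

/-! ## Execution in a global fixed-priority schedule -/

/-- The times at which task `i` executes. -/
def executing (run : Fin N → ℝ → Set ℝ) (i : Fin N) : Set ℝ := {t | ∃ r, t ∈ run i r}

/-- The times at which at least `M` tasks of higher priority than `k` execute. -/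
def saturated (M : ℕ) (run : Fin N → ℝ → Set ℝ) (k : Fin N) : Set ℝ :=
  {t | (M : ℝ) ≤ ∑ j ∈ Finset.Iio k, (executing run j).indicator (fun _ => (1 : ℝ)) t}

variable {M : ℕ}

namespace IsGlobalFPSchedule

theorem measurableSet_executing (h : IsGlobalFPSchedule M J run) (i : Fin N) :
    MeasurableSet (executing run i) := by
  have : executing run i = ⋃ r ∈ J.release i, run i r := by
    ext t
    simp only [executing, Set.mem_ofPred_eq, Set.mem_iUnion, exists_prop]
    exact ⟨fun ⟨r, hr⟩ => ⟨r, ((h.dispatch i r t).1 hr).1.1.1, hr⟩, fun ⟨r, _, hr⟩ => ⟨r, hr⟩⟩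
  rw [this]
  exact MeasurableSet.biUnion (release_countable J i) fun r _ => h.measurable i r

theorem measurableSet_saturated (h : IsGlobalFPSchedule M J run) (k : Fin N) :
    MeasurableSet (saturated M run k) :=
  measurableSet_le measurable_const (Finset.measurable_sum _ fun j _ =>
    measurable_const.indicator (h.measurableSet_executing j))

theorem service_le_exec (h : IsGlobalFPSchedule M J run) {i : Fin N} {r : ℝ}
    (hr : r ∈ J.release i) (t : ℝ) : service run i r t ≤ J.exec i r :=
  occ_le_of_forall_lt (J.exec_nonneg i r hr) (fun u hu _ => ((h.dispatch i r u).1 hu).1.1.2.2) t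

/-- A ready job of a task that waits does so because of `M` executing tasks of higher priority. -/
theorem mem_run_or_saturated (h : IsGlobalFPSchedule M J run) {j k : Fin N} (hjk : j ≤ k)
    {r t : ℝ} (hr : Ready J run j r t) : t ∈ run j r ∨ t ∈ saturated M run k := by
  classical
  by_contra! hcon
  -- For the waiting task of highest priority, all ready tasks above it execute, and there are at
  -- least `M` of them.
  obtain ⟨i, ⟨⟨r', hi, hni⟩, hik⟩, hmin⟩ := Set.exists_min_image
    {i : Fin N | (∃ r', Ready J run i r' t ∧ t ∉ run i r') ∧ i ≤ k} id (Set.toFinite _)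
    ⟨j, ⟨r, hr, hcon.1⟩, hjk⟩
  refine hcon.2 ?_
  have hM : M ≤ {j : Fin N | j < i ∧ ∃ r', Ready J run j r' t}.ncard := by
    by_contra! hlt
    exact hni ((h.dispatch i r' t).2 ⟨hi, hlt⟩)
  have hsub : {j : Fin N | j < i ∧ ∃ r', Ready J run j r' t} ⊆
      ((Finset.Iio k).filter fun j => t ∈ executing run j : Finset (Fin N)) := by
    rintro l ⟨hli, r'', hl⟩
    simp only [Finset.coe_filter, Finset.mem_Iio, Set.mem_ofPred_eq]
    refine ⟨hli.trans_le hik, r'', ?_⟩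
    by_contra hnl
    exact absurd (hmin l ⟨⟨r'', hl, hnl⟩, hli.le.trans hik⟩) (not_le.2 hli)
  have hcard := hM.trans (Set.ncard_le_ncard hsub (Finset.finite_toSet _))
  rw [Set.ncard_coe_finset] at hcard
  rw [saturated, Set.mem_ofPred_eq]
  simp only [Set.indicator_apply]
  rw [Finset.sum_boole]
  exact_mod_cast hcard

/-- The execution of a task from a time without backlog is bounded by the demand of its releases. -/
theorem occ_executing_le (h : IsGlobalFPSchedule M J run) {i : Fin N} {s : ℝ}
    (hs : ∀ r < s, ¬ Pending J run i r s) (b : ℝ) :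
    occ (executing run i) s b ≤ ⌈(b - s) / (τ i).T⌉₊ * (τ i).C := by
  set F := (release_finite_Ico J i s b).toFinset with hF
  -- Without backlog at `s`, only jobs released from `s` on execute.
  have hsub : executing run i ∩ Set.Ico s b ⊆ ⋃ r ∈ F, run i r ∩ Set.Ico r b := by
    rintro t ⟨⟨r, hr⟩, hst, htb⟩
    have hp := ((h.dispatch i r t).1 hr).1.1
    have hsr : s ≤ r := by
      by_contra! hlt
      exact hs r hlt (hp.anti hlt.le hst)
    simp only [Set.mem_iUnion]
    exact ⟨r, by simpa [hF] using ⟨hp.1, hsr, hp.2.1.trans_lt htb⟩, hr, hp.2.1, htb⟩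
  have hcard : (F.card : ℝ) ≤ ⌈(b - s) / (τ i).T⌉₊ := by
    have := ncard_release_Ico_le J i s b
    rw [Set.ncard_eq_toFinset_card _ (release_finite_Ico J i s b)] at this
    exact_mod_cast this
  calc occ (executing run i) s b
      ≤ MeasureTheory.volume.real (⋃ r ∈ F, run i r ∩ Set.Ico r b) :=
        MeasureTheory.measureReal_mono hsub
          ((MeasureTheory.measure_biUnion_lt_top F.finite_toSet fun r _ =>
            (volume_inter_Ico_ne_top _ _ _).lt_top).ne)
    _ ≤ ∑ r ∈ F, MeasureTheory.volume.real (run i r ∩ Set.Ico r b) :=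
        MeasureTheory.measureReal_biUnion_finset_le _ _
    _ ≤ ∑ _r ∈ F, (τ i).C := Finset.sum_le_sum fun r hr => by
        have hr' : r ∈ J.release i := ((release_finite_Ico J i s b).mem_toFinset.1 hr).1
        exact (h.service_le_exec hr' b).trans (J.exec_le i r hr')
    _ = F.card * (τ i).C := by simp
    _ ≤ _ := mul_le_mul_of_nonneg_right hcard (τ i).C_pos.le

end IsGlobalFPSchedule

end Schedule

/-! ## The quadratic bound -/

/-- The demand of a task after a backlog of length `φ`, in terms of its last release before `L`. -/
theorem exists_last_release (x : SporadicTask) {φ L : ℝ} (hφ : 0 ≤ φ) (hL : 0 < L) :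
    ∃ θ, 0 ≤ θ ∧ θ < L ∧ ∀ y, 0 < y → y ≤ L →
      ⌈(φ + y) / x.T⌉₊ * x.C - x.U * φ ≤ x.U * θ + if θ < y then x.C else 0 := by
  have hT := x.T_pos
  have hC := x.C_pos
  have hU := x.U_pos
  have hUT : x.U * x.T = x.C := div_mul_cancel₀ _ hT.ne'
  set n := ⌈(φ + L) / x.T⌉₊ with hn
  have hpos : 0 < (φ + L) / x.T := by positivity
  have hn1 : 1 ≤ n := Nat.ceil_pos.2 hpos
  have hn2 : ((n : ℝ) - 1) * x.T < φ + L := by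
    have := Nat.ceil_lt_add_one hpos.le
    rw [← hn] at this
    rw [← lt_div_iff₀ hT]; linarith
  -- With releases as dense as possible from `-φ` on, the `n`-th and last one is at `(n - 1) * T -
  -- φ`, where `U * θ = (n - 1) * C - U * φ`. Truncation at 0 only raises the bound.
  refine ⟨max 0 ((n - 1) * x.T - φ), le_max_left _ _, max_lt hL (by linarith), fun y hy hyL => ?_⟩
  have hθ : x.U * ((n - 1) * x.T - φ) ≤ x.U * max 0 ((n - 1) * x.T - φ) :=
    mul_le_mul_of_nonneg_left (le_max_right _ _) hU.le
  have hexp : x.U * ((n - 1) * x.T - φ) = n * x.C - x.C - x.U * φ := by rw [← hUT]; ring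
  split_ifs with h
  · have hle : (⌈(φ + y) / x.T⌉₊ : ℝ) ≤ n := by
      rw [hn]; gcongr
    nlinarith
  · have hy2 : y ≤ (n - 1) * x.T - φ := by
      rcases le_max_iff.1 (not_lt.1 h) with h | h
      · linarith
      · exact h
    have hle : (⌈(φ + y) / x.T⌉₊ : ℝ) ≤ n - 1 := by
      have : ⌈(φ + y) / x.T⌉₊ ≤ n - 1 := by
        rw [Nat.ceil_le, Nat.cast_sub hn1, div_le_iff₀ hT]
        push_cast; linarith
      calc (⌈(φ + y) / x.T⌉₊ : ℝ) ≤ ((n - 1 : ℕ) : ℝ) := by exact_mod_cast this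
        _ = n - 1 := by rw [Nat.cast_sub hn1]; simp
    nlinarith

/-- Under the quadratic bound the demand cannot exceed the supply throughout an interval. -/
theorem exists_demand_le {ι : Type*} (s : Finset ι) (x : ι → SporadicTask) {M D L Δ : ℝ}
    (hM : 0 < M) (hD : 0 < D) (hDL : D ≤ L) (hΔ : 0 ≤ Δ) (hU : ∑ i ∈ s, (x i).U < M)
    (hquad : Δ ≤ 1 - 1 / M * (∑ i ∈ s, (x i).U + (∑ i ∈ s, (x i).C) / D)
      + 1 / M ^ 2 * (pairForm s x / D))
    (θ : ι → ℝ) (hθ : ∀ i ∈ s, 0 ≤ θ i) (hθL : ∀ i ∈ s, θ i < L) :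
    ∃ y, 0 < y ∧ y ≤ L ∧
      ∑ i ∈ s, ((x i).U * θ i + if θ i < y then (x i).C else 0) ≤ M * (y - Δ * L) := by
  by_contra! hcon
  have hL : 0 < L := hD.trans_le hDL
  set u := ∑ i ∈ s, (x i).U with hu
  set c := ∑ i ∈ s, (x i).C with hc
  set P := pairForm s x with hP
  set V := ∑ i ∈ s, (x i).U * θ i with hV
  have hV0 : 0 ≤ V := Finset.sum_nonneg fun i hi => mul_nonneg (x i).U_pos.le (hθ i hi)
  have hc0 : 0 ≤ c := Finset.sum_nonneg fun i _ => (x i).C_pos.le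
  have hu0 : 0 ≤ u := Finset.sum_nonneg fun i _ => (x i).U_pos.le
  have hend : M * L < M * Δ * L + V + c := by
    have h := hcon L hL le_rfl
    rw [Finset.sum_add_distrib, Finset.sum_congr rfl fun i hi => if_pos (hθL i hi)] at h
    linarith
  -- The case `y = θ j`; for `θ j = 0` it holds trivially.
  have hrel : ∀ j ∈ s, M * θ j ≤ M * Δ * L + V + ∑ i ∈ s, if θ i < θ j then (x i).C else 0 := by
    intro j hj
    have hnn : 0 ≤ ∑ i ∈ s, if θ i < θ j then (x i).C else 0 :=
      Finset.sum_nonneg fun i _ => by split_ifs; exacts [(x i).C_pos.le, le_rfl]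
    rcases (hθ j hj).eq_or_lt with h | h
    · rw [← h] at hnn ⊢
      have : 0 ≤ M * Δ * L := by positivity
      linarith
    · have := hcon (θ j) h (hθL j hj).le
      rw [Finset.sum_add_distrib] at this
      linarith
  have hsum : M * V ≤ u * (M * Δ * L + V) + (u * c - P) := by
    have h1 : M * V ≤ ∑ j ∈ s, (x j).U *
        (M * Δ * L + V + ∑ i ∈ s, if θ i < θ j then (x i).C else 0) := by
      rw [hV, Finset.mul_sum]
      refine Finset.sum_le_sum fun j hj => ?_
      have := mul_le_mul_of_nonneg_left (hrel j hj) (x j).U_pos.le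
      linarith
    -- The pairs with `θ i < θ j` are complementary to those that `pairForm_le` bounds from below.
    have h2 : ∑ j ∈ s, (x j).U * ∑ i ∈ s, (if θ i < θ j then (x i).C else 0)
        + ∑ j ∈ s, ∑ i ∈ s, (if θ j ≤ θ i then (x j).U * (x i).C else 0) = u * c := by
      rw [hu, hc, Finset.sum_mul_sum, ← Finset.sum_add_distrib]
      refine Finset.sum_congr rfl fun j _ => ?_
      rw [Finset.mul_sum, ← Finset.sum_add_distrib]
      refine Finset.sum_congr rfl fun i _ => ?_
      rcases lt_or_ge (θ i) (θ j) with h | h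
      · simp [h, h.not_ge]
      · simp [h, h.not_gt]
    have h3 := pairForm_le s x θ
    simp only [mul_add, Finset.sum_add_distrib, ← Finset.sum_mul] at h1
    linarith
  have hPle : P ≤ u * c := pairForm_le_mul s x
  have hq : M * c - P ≤ D * (M ^ 2 * (1 - Δ) - M * u) := by
    have h := mul_le_mul_of_nonneg_left hquad (by positivity : 0 ≤ M ^ 2 * D)
    have e : M ^ 2 * D * (1 - 1 / M * (u + c / D) + 1 / M ^ 2 * (P / D))
        = M ^ 2 * D - M * (u * D + c) + P := by
      field_simp
    rw [e] at h
    linarith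
  have hq0 : 0 ≤ M * c - P := by
    have := mul_le_mul_of_nonneg_right hU.le hc0
    linarith
  have hK : 0 ≤ M ^ 2 * (1 - Δ) - M * u := by
    by_contra! hneg
    exact absurd (hq0.trans hq) (not_le.2 (mul_neg_of_pos_of_neg hD hneg))
  have hLK := mul_le_mul_of_nonneg_right hDL hK
  -- Multiplied by `M - u`, `hend` combines with `hsum` to cancel `V`. With `K = M ^ 2 * (1 - Δ) - M
  -- * u` this leaves `L * K < M * c - P ≤ D * K ≤ L * K`.
  have hfin := mul_lt_mul_of_pos_left hend (sub_pos.2 hU)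
  linarith

/-! ### Extending the problem window and meeting the deadline -/

section

variable {N M : ℕ} {τ : Fin N → SporadicTask} {J : JobPattern τ} {run : Fin N → ℝ → Set ℝ}

/-- A time to which a problem window can be extended such that no task of higher priority than `k`
has lagged behind the rate `Δ` since its backlog began. -/
theorem IsGlobalFPSchedule.exists_window_start (h : IsGlobalFPSchedule M J run) {k : Fin N}
    {r d Δ : ℝ} (hr : occ (saturated M run k)ᶜ r d < Δ * (d - r)) (hrd : r ≤ d) :
    ∃ t ≤ r, occ (saturated M run k)ᶜ t d < Δ * (d - t) ∧
      ∀ j < k, ∃ s ≤ t, (∀ r' < s, ¬ Pending J run j r' s) ∧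
        Δ * (t - s) ≤ occ (executing run j) s t := by
  set S := {t | t ≤ r ∧ (t = r ∨ ∃ j < k, t ∈ J.release j) ∧
    occ (saturated M run k)ᶜ t d < Δ * (d - t)} with hS
  have hfin : S.Finite := by
    refine ((Set.finite_iUnion fun j => release_finite_Iic J j r).insert r).subset ?_
    rintro t ⟨htr, rfl | ⟨j, -, hj⟩, -⟩
    · exact Or.inl rfl
    · exact Or.inr (Set.mem_iUnion.2 ⟨j, hj, htr⟩)
  obtain ⟨t, ⟨htr, -, ht⟩, hmin⟩ := Set.exists_min_image S id hfin ⟨r, le_rfl, Or.inl rfl, hr⟩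
  refine ⟨t, htr, ht, fun j hj => ?_⟩
  obtain ⟨s, hst, hsr, hs, hready⟩ := exists_backlog_start (J := J) (run := run) j t
  refine ⟨s, hst, hs, ?_⟩
  rcases hsr with rfl | hsr
  · simp [occ_self]
  rcases hst.eq_or_lt with rfl | hlt
  · simp [occ_self]
  -- Subtracting the window from `t` leaves more than `Δ * (t - s)` unsaturated time in `[s, t)`,
  -- during all of which the backlogged task `j` executes.
  have hns : ¬ occ (saturated M run k)ᶜ s d < Δ * (d - s) := fun hlt' =>
    absurd (hmin s ⟨hst.trans htr, Or.inr ⟨j, hj, hsr⟩, hlt'⟩) (not_le.2 hlt)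
  have hsub : occ (saturated M run k)ᶜ s t ≤ occ (executing run j) s t := by
    refine occ_le_occ fun u hu hsu hut => ?_
    obtain ⟨r', hr'⟩ := hready u hsu hut
    exact ⟨r', (h.mem_run_or_saturated hj.le hr').resolve_right hu⟩
  have := occ_add (saturated M run k)ᶜ hst (htr.trans hrd)
  linarith

/-- A job of task `k` that is ready from its release on meets its deadline. -/
theorem QuadraticTest.exec_le_service {k : Fin N} (hM : 0 < M) (hq : QuadraticTest M τ k)
    (h : IsGlobalFPSchedule M J run) {r : ℝ} (hr : r ∈ J.release k)
    (hprev : ∀ r' < r, ∀ t, r ≤ t → ¬ Pending J run k r' t) :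
    J.exec k r ≤ service run k r (r + (τ k).D) := by
  by_contra! hmiss
  obtain ⟨hU, -, hΔ⟩ := (quadraticTest_iff M τ k).1 hq
  obtain ⟨hΔk, hΔj⟩ := (deltaMax_le_iff τ k _).1 le_rfl
  set Δ := DeltaMax τ k
  have hC := (τ k).C_pos
  have hD := (τ k).D_pos
  have hΔ0 : 0 ≤ Δ := (div_pos hC hD).le.trans hΔk
  have hidle : occ (saturated M run k)ᶜ r (r + (τ k).D) < Δ * (r + (τ k).D - r) := by
    have h1 : occ (saturated M run k)ᶜ r (r + (τ k).D) ≤ occ (run k r) r (r + (τ k).D) := by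
      refine occ_le_occ fun u hu hru hud => ?_
      have hready : Ready J run k r u :=
        ⟨⟨hr, hru, (occ_mono_right (run k r) hru hud.le).trans_lt hmiss⟩,
          fun r' hr' => hprev r' hr' u hru⟩
      exact (h.mem_run_or_saturated le_rfl hready).resolve_right hu
    rw [div_le_iff₀ hD] at hΔk
    rw [add_sub_cancel_left]
    exact (h1.trans_lt hmiss).trans_le ((J.exec_le k r hr).trans hΔk)
  obtain ⟨t, htr, ht, hwin⟩ := h.exists_window_start hidle (by linarith)
  set L := r + (τ k).D - t with hL
  have hdem : ∀ j, ∃ θ, j < k → 0 ≤ θ ∧ θ < L ∧ ∀ y, 0 < y → y ≤ L →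
      occ (executing run j) t (t + y) ≤ (τ j).U * θ + if θ < y then (τ j).C else 0 := by
    intro j
    by_cases hj : j < k
    swap
    · exact ⟨0, fun h => absurd h hj⟩
    obtain ⟨s, hst, hs, hlag⟩ := hwin j hj
    obtain ⟨θ, h0, h1, hθ⟩ := exists_last_release (τ j) (sub_nonneg.2 hst)
      (by linarith : 0 < L)
    refine ⟨θ, fun _ => ⟨h0, h1, fun y hy hyL => le_trans ?_ (hθ y hy hyL)⟩⟩
    have h2 := h.occ_executing_le hs (t + y)
    rw [show t + y - s = t - s + y by ring] at h2
    have h3 := occ_add (executing run j) hst (by linarith : t ≤ t + y)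
    -- Of the demand since `s`, at least `Δ * (t - s) ≥ U_j * (t - s)` was served before `t`.
    have h4 := mul_le_mul_of_nonneg_right (hΔj j hj) (sub_nonneg.2 hst)
    linarith
  choose θ hθ using hdem
  have hM' : (0 : ℝ) < M := by exact_mod_cast hM
  obtain ⟨y, hy, hyL, hle⟩ := exists_demand_le (Finset.Iio k) τ hM' hD
    (by linarith : (τ k).D ≤ L) hΔ0 (by linarith [(τ k).U_pos]) hΔ θ
    (fun i hi => (hθ i (Finset.mem_Iio.1 hi)).1) (fun i hi => (hθ i (Finset.mem_Iio.1 hi)).2.1)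
  have h1 := mul_occ_le_sum_occ (Finset.Iio k) (executing run) (h.measurableSet_executing)
    (h.measurableSet_saturated k) M (fun _ ht => ht) t (t + y)
  have h2 : ∑ j ∈ Finset.Iio k, occ (executing run j) t (t + y) ≤ _ :=
    Finset.sum_le_sum fun j hj => (hθ j (Finset.mem_Iio.1 hj)).2.2 y hy hyL
  have h3 := occ_add_occ_compl (h.measurableSet_saturated k) (by linarith : t ≤ t + y)
  -- A prefix has no more unsaturated time than the whole window, hence less than `Δ * L`.
  have h4 := occ_mono_right (saturated M run k)ᶜ (by linarith : t ≤ t + y)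
    (by linarith : t + y ≤ r + (τ k).D)
  have h5 : (M : ℝ) * (y - Δ * L) < M * occ (saturated M run k) t (t + y) :=
    mul_lt_mul_of_pos_left (by linarith) hM'
  linarith

end

theorem QuadraticTest.schedulable {N M : ℕ} {τ : Fin N → SporadicTask} {k : Fin N} (hM : 0 < M)
    (hτ : (τ k).D ≤ (τ k).T) (hq : QuadraticTest M τ k) : Schedulable M τ k := by
  intro J run h r hr
  -- This index strictly increases along the releases of task `k`.
  induction hn : ⌊r / (τ k).T⌋₊ using Nat.strong_induction_on generalizing r with
  | _ n ih =>
  subst hn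
  refine hq.exec_le_service hM h hr fun r' hr' t ht hp => ?_
  have hT := (τ k).T_pos
  have hsep := J.separated k r' hp.1 r hr hr'
  have hlt : ⌊r' / (τ k).T⌋₊ < ⌊r / (τ k).T⌋₊ := by
    rw [Nat.lt_iff_add_one_le, ← Nat.floor_add_one (div_nonneg (J.release_nonneg k r' hp.1) hT.le)]
    refine Nat.floor_le_floor ?_
    rw [div_add_one hT.ne']
    gcongr
  have h1 := ih _ hlt r' hp.1 rfl
  -- By the constrained deadline, `r' + D ≤ r' + T ≤ r ≤ t`.
  have h2 : service run k r' (r' + (τ k).D) ≤ service run k r' t :=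
    occ_mono_right _ (by linarith [(τ k).D_pos]) (by linarith)
  exact absurd hp.2.2 (not_lt.2 (h1.trans h2))

end GlobalFP

open GlobalFP in
/-- Tasks are numbered from `0` in Lean, so that `k` has `(k : ℕ)` tasks of higher priority and the
number called `k` in the running time `O(k log k)` is `(k : ℕ) + 1`. -/
theorem theorem4 :
    (∀ (N M : ℕ) (τ : Fin N → SporadicTask) (k : Fin N), 0 < M → ConstrainedDeadlines τ →
      QuadraticTest M τ k → Schedulable M τ k) ∧
    (∃ (P : Program) (c : ℝ), ∀ (N M : ℕ) (τ : Fin N → SporadicTask) (k : Fin N), 0 < M →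
      0 < (k : ℕ) →
      ∃ (b : Bool) (n : ℕ), RunsTo P (encodeInput M τ k) (encodeBool b) n ∧
        (b = true ↔ QuadraticTest M τ k) ∧
        (n : ℝ) ≤ c * (((k : ℕ) + 1 : ℝ) * Real.log ((k : ℕ) + 1 : ℝ))) := by
  refine ⟨fun N M τ k hM hτ hq => hq.schedulable hM (hτ k), testProgram, 2000,
    fun N M τ k hM hk => ?_⟩
  obtain ⟨b, n, hrun, hb, hn⟩ := test_runs M τ k hM hk
  exact ⟨b, n, hrun, hb, (Nat.cast_le.2 hn).trans (clog_bound k hk)⟩
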